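/- All spaces are Hausdorff. Let $X$ be a compact space. Its Alexandroff duplicate $AD(X)$ is the set $X\times\{0,1\}$ with the topology in which all points of $X\times\{1\}$ are isolated and the basic neighbourhoods of $(x,0)$ are the sets $(U\times\{0,1\})\setminus\{(x,1)\}$, where $U$ is an open neighbourhood of $x$ in $X$. A space is cosmic if it has a countable network. A retraction in a space $Z$ is a continuous map $r:Z\to Z$ with $r\circ r=r$. A partially ordered set is $\sigma$-complete if every increasing sequence $s_0\le s_1\le\cdots$ in it has a supremum in it. An $r$-skeleton on a space $Z$ is a family $\{r_s:s\in\Gamma\}$ of retractions in $Z$, indexed by a non-empty up-directed $\sigma$-complete partially ordered set $\Gamma$, such that (i) each $r_s(Z)$ is cosmic; (ii) $r_s=r_s\circ r_t=r_t\circ r_s$ whenever $s\le t$; (iii) if $s_0\le s_1\le\cdots$ in $\Gamma$ and $s=\sup_n s_n$, then $r_s(x)=\lim_{n\to\infty}r_{s_n}(x)$ for every $x\in Z$; (iv) $x=\lim_{s\in\Gamma}r_s(x)$ for every $x\in Z$. Its induced space is $\bigcup_{s\in\Gamma}r_s(Z)$. For a set $S$, $[S]^{\le\omega}$ denotes the set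 of all countable (possibly finite or empty) subsets of $S$; for $Y\subseteq X$ the product $[Y]^{\le\omega}\times[X\setminus Y]^{\le\omega}$ is ordered by $(A,B)\preceq(A',B')$ iff $A\subseteq A'$ and $B\subseteq B'$. A subset $\Gamma$ of this product is $\sigma$-closed if it contains the supremum $(\bigcup_nA_n,\bigcup_nB_n)$ of each increasing sequence $\langle(A_n,B_n)\rangle_{n<\omega}$ of its elements, and cofinal if every element of the product is $\preceq$ some element of $\Gamma$. Theorem. Let $X$ be a compact space. Then $AD(X)$ admits an $r$-skeleton if and only if there are a set $Y\subseteq X$, a subset $\Gamma\subseteq[Y]^{\le\omega}\times[X\setminus Y]^{\le\omega}$ that is $\sigma$-closed and cofinal in $[Y]^{\le\omega}\times[X\setminus Y]^{\le\omega}$, and an $r$-skeleton $\{r_{(A,B)}:(A,B)\in\Gamma\}$ on $X$, indexed by $\Gamma$ with the order $\preceq$, whose induced space is $Y$, such that for every $B\in[X\setminus Y]^{\le\omega}$: $(*)$ $B$ is discrete in $X\setminus Y$ (that is, a discrete subspace); $(**)$ $cl_X(B)\setminus B\subseteq Y$, and $cl_X(B)\setminus B$ is cosmic; and for every $(A,B)\in\Gamma$: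 $(***)$ $A\subseteq r_{(A,B)}(X)$ and $cl_X(B)\setminus B\subseteq r_{(A,B)}(X)$. -/

import Mathlib

open Set Filter Topology

universe u v w z

/-- A topological space is cosmic if it has a countable network. -/
def IsCosmicSpace (X : Type*) [TopologicalSpace X] : Prop :=
  ∃ N : Set (Set X), N.Countable ∧
    ∀ (x : X) (U : Set X), IsOpen U → x ∈ U → ∃ P ∈ N, x ∈ P ∧ P ⊆ U

/-- A retraction in `X`: a continuous idempotent self-map. -/
def IsRetraction {X : Type*} [TopologicalSpace X] (f : X → X) : Prop :=
  Continuous f ∧ ∀ x, f (f x) = f x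

/-- The family `r`, indexed by the partially ordered set `Γ`, is an `r`-skeleton on `X`. -/
structure IsRSkeleton {X : Type*} [TopologicalSpace X] {Γ : Type*} [PartialOrder Γ]
    (r : Γ → X → X) : Prop where
  /-- The index set is non-empty and up-directed. -/
  nonempty : Nonempty Γ
  directed : ∀ s t : Γ, ∃ u, s ≤ u ∧ t ≤ u
  /-- The index set is `σ`-complete. -/
  sigmaComplete : ∀ s : ℕ → Γ, Monotone s → ∃ t, IsLUB (range s) t
  retraction : ∀ s, IsRetraction (r s)
  cosmic : ∀ s, IsCosmicSpace (range (r s))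
  comp : ∀ s t, s ≤ t → r s = r s ∘ r t ∧ r s = r t ∘ r s
  tendsto_sup : ∀ (s : ℕ → Γ) (t : Γ), Monotone s → IsLUB (range s) t →
    ∀ x, Tendsto (fun n => r (s n) x) atTop (𝓝 (r t x))
  tendsto_id : ∀ x, Tendsto (fun s => r s x) atTop (𝓝 x)

/-- The subspace of `X` induced by a family of self-maps: the union of the images. -/
def inducedSpace {X Γ : Type*} (r : Γ → X → X) : Set X :=
  ⋃ s, range (r s)

/-- `X` admits an `r`-skeleton (indexed by a partially ordered set in the universe `w`). -/
def AdmitsRSkeleton (X : Type z) [TopologicalSpace X] : Prop :=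
  ∃ (Γ : Type w) (_ : PartialOrder Γ) (r : Γ → X → X), IsRSkeleton r

/-- The set of the countable subsets of `Y ⊆ X`, ordered by inclusion. -/
abbrev CountableSubsets {X : Type*} (Y : Set X) : Type _ :=
  {A : Set X // A ⊆ Y ∧ A.Countable}

/-- A subset of a partially ordered set is `σ`-closed if it contains the supremum of every
increasing sequence of its elements. -/
def IsSigmaClosed {P : Type*} [PartialOrder P] (Γ : Set P) : Prop :=
  ∀ (s : ℕ → P) (t : P), Monotone s → (∀ n, s n ∈ Γ) → IsLUB (range s) t → t ∈ Γ

/-- The underlying set `X × {0, 1}` of the Alexandroff duplicate of `X`; the tag is `false` for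
the points of `X × {0}` and `true` for the points of `X × {1}`. -/
@[ext]
structure AlexandroffDuplicate (X : Type*) where
  point : X
  tag : Bool

namespace AlexandroffDuplicate

/-- The basic neighbourhood `(U × {0, 1}) \ {(x, 1)}` of `(x, 0)`. -/
def basicNhd {X : Type*} (U : Set X) (x : X) : Set (AlexandroffDuplicate X) :=
  {p | p.point ∈ U} \ {⟨x, true⟩}

/-- A set is open if, with each of its points `(x, 0)`, it contains a basic neighbourhood of that
point; there is no condition at the points `(x, 1)`, which are isolated. -/
instance {X : Type*} [TopologicalSpace X] : TopologicalSpace (AlexandroffDuplicate X) where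
  IsOpen S := ∀ x : X, ⟨x, false⟩ ∈ S → ∃ U : Set X, IsOpen U ∧ x ∈ U ∧ basicNhd U x ⊆ S
  isOpen_univ _ _ := ⟨univ, isOpen_univ, mem_univ _, subset_univ _⟩
  isOpen_inter S T hS hT x hx := by
    obtain ⟨U, hU, hxU, hUS⟩ := hS x hx.1
    obtain ⟨V, hV, hxV, hVT⟩ := hT x hx.2
    exact ⟨U ∩ V, hU.inter hV, ⟨hxU, hxV⟩,
      fun p hp => ⟨hUS ⟨hp.1.1, hp.2⟩, hVT ⟨hp.1.2, hp.2⟩⟩⟩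
  isOpen_sUnion F hF x hx := by
    obtain ⟨S, hS, hxS⟩ := hx
    obtain ⟨U, hU, hxU, hUS⟩ := hF S hS x hxS
    exact ⟨U, hU, hxU, hUS.trans (subset_sUnion_of_mem hS)⟩

/-- The points of `X × {1}` are isolated. -/
theorem isOpen_singleton_true {X : Type*} [TopologicalSpace X] (x : X) :
    IsOpen ({⟨x, true⟩} : Set (AlexandroffDuplicate X)) := by
  intro y hy
  simp at hy

/-- The sets `(U × {0, 1}) \ {(x, 1)}` form a base of neighbourhoods of `(x, 0)`. -/
theorem nhds_false_hasBasis {X : Type*} [TopologicalSpace X] [T1Space X] (x : X) :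
    (𝓝 (⟨x, false⟩ : AlexandroffDuplicate X)).HasBasis
      (fun U : Set X => IsOpen U ∧ x ∈ U) (fun U => basicNhd U x) := by
  have key : ∀ U : Set X, IsOpen U → IsOpen (basicNhd U x) := by
    intro U hU y hy
    by_cases h : y = x
    · subst h
      exact ⟨U, hU, hy.1, Subset.rfl⟩
    · refine ⟨U \ {x}, hU.sdiff isClosed_singleton, ⟨hy.1, h⟩, fun p hp => ⟨hp.1.1, ?_⟩⟩
      rintro rfl
      exact hp.1.2 rfl
  refine ⟨fun S => ⟨fun hS => ?_, ?_⟩⟩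
  · obtain ⟨T, hTS, hT, hxT⟩ := mem_nhds_iff.1 hS
    obtain ⟨U, hU, hxU, hUT⟩ := hT x hxT
    exact ⟨U, ⟨hU, hxU⟩, hUT.trans hTS⟩
  · rintro ⟨U, ⟨hU, hxU⟩, hUS⟩
    exact mem_nhds_iff.2 ⟨_, hUS, key U hU, hxU, by simp⟩

end AlexandroffDuplicate

/-! ### Cosmic spaces -/

/-! From $X$ to $AD(X)$: extend $r_{(A,B)}$ by fixing $(x,1)$ for $x\in A\cup B$ and sending every
other $p$ to $(r_{(A,B)}(\text{point of }p),0)$. By (*) and (***), near a point $x$ not fixed by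
$r_{(A,B)}$ the other points of $A\cup B$ are all fixed by it, which gives continuity
(`continuous_extend`); the skeleton conditions then transfer.

From $AD(X)$ to $X$: let $Y$ be the set of $x$ with $(x,0)$ in the induced space of the skeleton
$R$. Each $(x,1)$ is isolated, hence in the induced space, and countably many such points lie in one
closed cosmic range. If $y$ accumulates at a countable $B$, then $(y,0)$ is in the closure of
$B\times\{1\}$, hence in that range. This yields (*) and (**), and also that $Y$ is dense.
Restricting $R_s$ to $X\times\{0\}$ needs $R_s$ to preserve it. Such $s$ form a $\sigma$-closed
cofinal set (`isCofinal_preservingIndices`), so a monotone sup-preserving map $\psi$ from countable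
sets into it exists (`exists_monotone_countable_map`). The skeleton on $X$ is the restriction of
$R_{\psi(A\cup B)}$, over all pairs $(A,B)$. The image of $\psi$ need not be cofinal, so condition
(iv) is recovered from density of $Y$ (`tendsto_id_of_dense_inducedSpace`). -/

theorem IsCosmicSpace.of_isInducing {X Y : Type*} [TopologicalSpace X] [TopologicalSpace Y]
    (hY : IsCosmicSpace Y) {f : X → Y} (hf : IsInducing f) : IsCosmicSpace X := by
  obtain ⟨N, hN, h⟩ := hY
  refine ⟨preimage f '' N, hN.image _, fun x U hU hx => ?_⟩
  obtain ⟨V, hV, rfl⟩ := hf.isOpen_iff.1 hU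
  obtain ⟨P, hP, hxP, hPV⟩ := h (f x) V hV hx
  exact ⟨_, mem_image_of_mem _ hP, hxP, preimage_mono hPV⟩

/-- A network member that contains an isolated point and lies inside its singleton equals that
singleton, so isolated points inject into the network. -/
theorem IsCosmicSpace.countable_isolated {X : Type*} [TopologicalSpace X] {A : Set X}
    (hA : IsCosmicSpace A) : {x ∈ A | IsOpen ({x} : Set X)}.Countable := by
  obtain ⟨N, hN, h⟩ := hA
  have key : ∀ x ∈ A, IsOpen ({x} : Set X) → ((↑) : A → X) ⁻¹' {x} ∈ N := by
    intro x hx hxo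
    obtain ⟨P, hP, hxP, hPx⟩ := h ⟨x, hx⟩ _ (hxo.preimage continuous_subtype_val) rfl
    convert hP
    refine Subset.antisymm ?_ hPx
    rintro ⟨y, hy⟩ (rfl : y = x)
    exact hxP
  refine Set.MapsTo.countable_of_injOn (t := N) (f := fun x => ((↑) : A → X) ⁻¹' {x})
    (fun x hx => key x hx.1 hx.2) ?_ hN
  intro x hx y hy hxy
  have : (⟨x, hx.1⟩ : A) ∈ ((↑) : A → X) ⁻¹' {y} := by
    rw [← show ((↑) : A → X) ⁻¹' {x} = ((↑) : A → X) ⁻¹' {y} from hxy]; rfl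
  exact this

/-- The union of the image of a cosmic space and a countable set is cosmic. -/
theorem IsCosmicSpace.of_subset_image_union {X Y : Type*} [TopologicalSpace X]
    [TopologicalSpace Y] {A : Set X} (hA : IsCosmicSpace A) {f : X → Y} (hf : Continuous f)
    {C B : Set Y} (hC : C.Countable) (hB : B ⊆ f '' A ∪ C) : IsCosmicSpace B := by
  obtain ⟨N, hN, h⟩ := hA
  refine ⟨(fun P : Set A => ((↑) : B → Y) ⁻¹' (f '' ((↑) '' P))) '' N ∪
    (fun y => ((↑) : B → Y) ⁻¹' {y}) '' C, (hN.image _).union (hC.image _), ?_⟩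
  rintro ⟨y, hy⟩ U hU hyU
  obtain ⟨V, hV, rfl⟩ := isOpen_induced_iff.1 hU
  rcases hB hy with ⟨x, hx, rfl⟩ | hyC
  · obtain ⟨P, hP, hxP, hPV⟩ := h ⟨x, hx⟩ ((↑) ⁻¹' (f ⁻¹' V))
      ((hV.preimage hf).preimage continuous_subtype_val) hyU
    refine ⟨_, Or.inl (mem_image_of_mem _ hP), ⟨x, ⟨⟨x, hx⟩, hxP, rfl⟩, rfl⟩, ?_⟩
    rintro ⟨_, _⟩ ⟨_, ⟨a, ha, rfl⟩, rfl⟩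
    exact hPV ha
  · refine ⟨_, Or.inr (mem_image_of_mem _ hyC), rfl, ?_⟩
    rintro ⟨_, _⟩ rfl
    exact hyU

/-! ### Directed and `σ`-complete partially ordered sets -/

section Sigma

variable {Γ : Type*} [PartialOrder Γ]

/-- A monotone map on finite sets which dominates a given map on points and takes values in a
given cofinal set. -/
theorem exists_monotone_finset_map {I : Type*} (hne : Nonempty Γ)
    (hdir : ∀ s t : Γ, ∃ u, s ≤ u ∧ t ≤ u) {G : Set Γ} (hG : IsCofinal G) (g : I → Γ) :
    ∃ φ : Finset I → Γ, Monotone φ ∧ (∀ F, φ F ∈ G) ∧ ∀ F, ∀ i ∈ F, g i ≤ φ F := by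
  classical
  have : IsDirectedOrder Γ := ⟨hdir⟩
  -- Strong recursion on finite sets: dominating the values at all proper subsets is what makes `φ`
  -- monotone.
  have key : ∀ F : Finset I, ∀ p : (t : Finset I) → t ⊂ F → Γ,
      ∃ u ∈ G, (∀ t h, p t h ≤ u) ∧ ∀ i ∈ F, g i ≤ u := by
    intro F p
    let S : Finset Γ := F.ssubsets.attach.image fun t => p t.1 (Finset.mem_ssubsets.1 t.2)
    obtain ⟨M₁, h₁⟩ := Finset.exists_le S
    obtain ⟨M₂, h₂⟩ := Finset.exists_le (F.image g)
    obtain ⟨M, hM₁, hM₂⟩ := hdir M₁ M₂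
    obtain ⟨u, hu, hMu⟩ := hG M
    refine ⟨u, hu, fun t h => (h₁ _ ?_).trans (hM₁.trans hMu), fun i hi =>
      (h₂ _ (Finset.mem_image_of_mem g hi)).trans (hM₂.trans hMu)⟩
    exact Finset.mem_image.2 ⟨⟨t, Finset.mem_ssubsets.2 h⟩, Finset.mem_attach _ _, rfl⟩
  choose u huG hup hug using key
  let φ : Finset I → Γ := fun F => Finset.strongInduction (p := fun _ => Γ) u F
  have hφ : ∀ F, φ F = u F (fun t _ => φ t) := fun F => Finset.strongInduction_eq u F
  refine ⟨φ, fun F F' h => ?_, fun F => hφ F ▸ huG _ _, fun F i hi => hφ F ▸ hug _ _ i hi⟩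
  rcases h.eq_or_ssubset with rfl | h
  · exact le_rfl
  · rw [hφ F']
    exact hup F' (fun t _ => φ t) F h

theorem Set.Countable.exists_monotone_finset {I : Type*} {C : Set I} (hC : C.Countable) :
    ∃ F : ℕ → Finset I, Monotone F ∧ ⋃ n, (F n : Set I) = C := by
  classical
  rcases C.eq_empty_or_nonempty with rfl | hne
  · exact ⟨fun _ => ∅, monotone_const, by simp⟩
  · obtain ⟨f, rfl⟩ := hC.exists_eq_range hne
    refine ⟨fun n => (Finset.range (n + 1)).image f, fun m n h =>
      Finset.image_subset_image (Finset.range_subset_range.2 (by omega)), ?_⟩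
    ext x
    simp only [mem_iUnion, Finset.coe_image, mem_image, mem_range, Finset.coe_range, mem_Iio]
    exact ⟨fun ⟨n, m, _, h⟩ => ⟨m, h⟩, fun ⟨m, h⟩ => ⟨m, m, by omega, h⟩⟩

/-- In a directed `σ`-complete partially ordered set, a map on points extends to a monotone map
on countable sets which preserves suprema of increasing sequences and takes values in a given
`σ`-closed cofinal set. -/
theorem exists_monotone_countable_map {I : Type*} (hne : Nonempty Γ)
    (hdir : ∀ s t : Γ, ∃ u, s ≤ u ∧ t ≤ u)
    (hsup : ∀ s : ℕ → Γ, Monotone s → ∃ t, IsLUB (range s) t)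
    {G : Set Γ} (hG : IsCofinal G) (hGσ : IsSigmaClosed G) (g : I → Γ) :
    ∃ ψ : Set I → Γ, (∀ C, C.Countable → ψ C ∈ G) ∧ (∀ C, C.Countable → ∀ i ∈ C, g i ≤ ψ C) ∧
      (∀ C C', C.Countable → C'.Countable → C ⊆ C' → ψ C ≤ ψ C') ∧
      ∀ C : ℕ → Set I, Monotone C → (∀ n, (C n).Countable) →
        IsLUB (range fun n => ψ (C n)) (ψ (⋃ n, C n)) := by
  classical
  obtain ⟨φ, hφ, hφG, hφg⟩ := exists_monotone_finset_map hne hdir hG g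
  -- `ψ C` is the supremum of `φ` over the finite subsets of `C`. It exists because an increasing
  -- sequence of finite sets exhausting `C` is cofinal among them; for uncountable `C` the value is
  -- arbitrary.
  have key : ∀ C : Set I, ∃ t, C.Countable → t ∈ G ∧ IsLUB (φ '' {F | (F : Set I) ⊆ C}) t := by
    intro C
    by_cases hC : C.Countable
    · obtain ⟨F, hF, rfl⟩ := hC.exists_monotone_finset
      obtain ⟨t, ht⟩ := hsup (fun n => φ (F n)) (hφ.comp hF)
      refine ⟨t, fun _ => ⟨hGσ _ t (hφ.comp hF) (fun n => hφG _) ht, ?_, fun b hb => ht.2 ?_⟩⟩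
      · rintro _ ⟨E, hE, rfl⟩
        obtain ⟨n, hn⟩ := Directed.exists_mem_subset_of_finset_subset_biUnion
          (f := fun n => (F n : Set I))
          (directed_of_isDirected_le fun m n h => Finset.coe_subset.2 (hF h)) hE
        exact (hφ (Finset.coe_subset.1 hn)).trans (ht.1 ⟨n, rfl⟩)
      · rintro _ ⟨n, rfl⟩
        exact hb ⟨F n, subset_iUnion (fun n => (F n : Set I)) n, rfl⟩
    · exact ⟨hne.some, fun h => absurd h hC⟩
  choose ψ hψ using key
  have hmono : ∀ C C', C.Countable → C'.Countable → C ⊆ C' → ψ C ≤ ψ C' := by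
    intro C C' hC hC' h
    exact (hψ C hC).2.mono (hψ C' hC').2 (image_mono fun F hF => Subset.trans hF h)
  refine ⟨ψ, fun C hC => (hψ C hC).1, fun C hC i hi => ?_, hmono, fun C hCm hC => ?_⟩
  · exact (hφg {i} i (by simp)).trans ((hψ C hC).2.1 ⟨{i}, by simpa using hi, rfl⟩)
  · refine ⟨?_, fun b hb => ?_⟩
    · rintro _ ⟨n, rfl⟩
      exact hmono _ _ (hC n) (countable_iUnion hC) (subset_iUnion C n)
    · refine (hψ _ (countable_iUnion hC)).2.2 ?_
      rintro _ ⟨F, hF, rfl⟩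
      obtain ⟨n, hn⟩ := Directed.exists_mem_subset_of_finset_subset_biUnion
        (directed_of_isDirected_le hCm) hF
      exact ((hψ _ (hC n)).2.1 ⟨F, hn, rfl⟩).trans (hb ⟨n, rfl⟩)

/-- In a directed `σ`-complete partially ordered set, countable families are bounded above. -/
theorem exists_upper_bound_of_countable (hne : Nonempty Γ)
    (hdir : ∀ s t : Γ, ∃ u, s ≤ u ∧ t ≤ u)
    (hsup : ∀ s : ℕ → Γ, Monotone s → ∃ t, IsLUB (range s) t)
    {I : Type*} {C : Set I} (hC : C.Countable) (g : I → Γ) : ∃ t, ∀ i ∈ C, g i ≤ t := by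
  obtain ⟨ψ, -, h, -⟩ := exists_monotone_countable_map (G := univ) hne hdir hsup
    (fun x => ⟨x, mem_univ x, le_rfl⟩) (fun _ _ _ _ _ => mem_univ _) g
  exact ⟨ψ C, h C hC⟩

end Sigma

/-! ### Inverse sequences of maps on a compact space -/

/-- Compactness: the pairs in `K × K` outside `V` identified by `f n` form a decreasing sequence of
compact sets. A common pair would be identified by every `f n`, so its coordinates, being limits of
the same sequence, would agree. -/
theorem exists_forall_map_eq_imp_mem {X : Type*} [TopologicalSpace X] [T2Space X]
    {f : ℕ → X → X} (hf : ∀ n, Continuous (f n))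
    (hcomp : ∀ m n, m ≤ n → ∀ x, f m (f n x) = f m x) {K : Set X} (hK : IsCompact K)
    (hlim : ∀ x ∈ K, Tendsto (fun n => f n x) atTop (𝓝 x)) {V : Set (X × X)} (hV : IsOpen V)
    (hdiag : ∀ x, (x, x) ∈ V) :
    ∃ N, ∀ n, N ≤ n → ∀ x ∈ K, ∀ y ∈ K, f n x = f n y → (x, y) ∈ V := by
  have hstep : ∀ m n, m ≤ n → ∀ x y, f n x = f n y → f m x = f m y := by
    intro m n h x y hxy
    rw [← hcomp m n h x, ← hcomp m n h y, hxy]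
  suffices ∃ N, ∀ x ∈ K, ∀ y ∈ K, f N x = f N y → (x, y) ∈ V by
    obtain ⟨N, hN⟩ := this
    exact ⟨N, fun n hn x hx y hy h => hN x hx y hy (hstep N n hn x y h)⟩
  by_contra! hcon
  have hclosed : ∀ n, IsClosed {p : X × X | f n p.1 = f n p.2} := fun n =>
    isClosed_eq ((hf n).comp continuous_fst) ((hf n).comp continuous_snd)
  obtain ⟨⟨x, y⟩, hxy⟩ := IsCompact.nonempty_iInter_of_sequence_nonempty_isCompact_isClosed
    (fun n => (K ×ˢ K ∩ {p : X × X | f n p.1 = f n p.2}) \ V)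
    (fun n p hp => ⟨⟨hp.1.1, hstep _ _ n.le_succ _ _ hp.1.2⟩, hp.2⟩)
    (fun n => by
      obtain ⟨x, hx, y, hy, h, hV⟩ := hcon n
      exact ⟨(x, y), ⟨⟨hx, hy⟩, h⟩, hV⟩)
    (((hK.prod hK).inter_right (hclosed 0)).diff hV)
    (fun n => (((hK.prod hK).isClosed.inter (hclosed n)).sdiff hV))
  rw [mem_iInter] at hxy
  have heq : x = y := by
    have hy := hlim y (hxy 0).1.1.2
    simp_rw [fun n => ((hxy n).1.2 : f n x = f n y).symm] at hy
    exact tendsto_nhds_unique (hlim x (hxy 0).1.1.1) hy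
  subst heq
  exact (hxy 0).2 (hdiag x)

/-! ### Properties of `r`-skeletons -/

/-- In a compact space the last condition on an `r`-skeleton follows from the density of the
induced space. -/
theorem tendsto_id_of_dense_inducedSpace {X : Type*} [TopologicalSpace X] [CompactSpace X]
    [T2Space X] {Γ : Type*} [PartialOrder Γ] {r : Γ → X → X} (hne : Nonempty Γ)
    (hdir : ∀ s t : Γ, ∃ u, s ≤ u ∧ t ≤ u)
    (hsup : ∀ s : ℕ → Γ, Monotone s → ∃ t, IsLUB (range s) t)
    (hret : ∀ s, IsRetraction (r s)) (hcomp : ∀ s t, s ≤ t → r s = r s ∘ r t ∧ r s = r t ∘ r s)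
    (hlim : ∀ (s : ℕ → Γ) (t : Γ), Monotone s → IsLUB (range s) t →
      ∀ x, Tendsto (fun n => r (s n) x) atTop (𝓝 (r t x)))
    (hdense : Dense (inducedSpace r)) (x : X) : Tendsto (fun s => r s x) atTop (𝓝 x) := by
  let _ : UniformSpace X := uniformSpaceOfCompactR1
  have hmem : ∀ s t, s ≤ t → ∀ y ∈ range (r s), r t y = y := by
    rintro s t hst _ ⟨y, rfl⟩
    exact (congrFun (hcomp s t hst).2 y).symm
  have main : ∀ W ∈ uniformity X, ∃ s, ∀ x, (x, r s x) ∈ W := by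
    intro W hW
    -- A closed entourage lets the estimate pass from the dense induced space to all of `X`.
    obtain ⟨W', hW', hW'c, hW'W⟩ := mem_uniformity_isClosed hW
    suffices ∃ s, ∀ x ∈ inducedSpace r, (x, r s x) ∈ W' by
      obtain ⟨s, hs⟩ := this
      refine ⟨s, fun x => hW'W ?_⟩
      have hc : IsClosed {x | (x, r s x) ∈ W'} :=
        hW'c.preimage (continuous_id.prodMk (hret s).1)
      exact hc.closure_subset_iff.2 hs (hdense x)
    by_contra! hcon
    have hnext : ∀ s, ∃ t, s ≤ t ∧ ∃ x, (x, r s x) ∉ W' ∧ r t x = x := by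
      intro s
      obtain ⟨x, hx, hxW⟩ := hcon s
      obtain ⟨a, ha⟩ := mem_iUnion.1 hx
      obtain ⟨t, hst, hat⟩ := hdir s a
      exact ⟨t, hst, x, hxW, hmem a t hat x ha⟩
    choose next hle p hpW hp using hnext
    let s : ℕ → Γ := fun n => next^[n] hne.some
    have hsucc : ∀ n, s (n + 1) = next (s n) := fun n => Function.iterate_succ_apply' _ _ _
    have hs : Monotone s := monotone_nat_of_le_succ fun n => hsucc n ▸ hle (s n)
    obtain ⟨t, ht⟩ := hsup s hs
    have hst : ∀ n, s n ≤ t := fun n => ht.1 ⟨n, rfl⟩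
    obtain ⟨n, hn⟩ := exists_forall_map_eq_imp_mem (fun n => (hret (s n)).1)
      (fun m n h x => (congrFun (hcomp _ _ (hs h)).1 x).symm) (isCompact_range (hret t).1)
      (fun x hx => by
        obtain ⟨y, rfl⟩ := hx
        simpa only [(hret t).2] using hlim s t hs ht (r t y))
      isOpen_interior (fun x => mem_interior_iff_mem_nhds.2 (nhds_le_uniformity x hW'))
    -- The points `p (s n)` and `r (s n) (p (s n))` lie in the range of `r t` and have the same
    -- image under `r (s n)`, so they must be `W'`-close.
    refine hpW (s n) (interior_subset (hn n le_rfl _ ⟨p (s n), ?_⟩ _ ⟨r (s n) (p (s n)), ?_⟩ ?_))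
    · exact hmem _ _ (hsucc n ▸ hst (n + 1)) _ ⟨_, hp (s n)⟩
    · exact hmem _ _ (hst n) _ ⟨_, rfl⟩
    · exact ((hret (s n)).2 _).symm
  rw [Uniform.tendsto_nhds_right]
  intro W hW
  obtain ⟨W₁, hW₁, hsymm, hW₁W⟩ := comp_symm_mem_uniformity_sets hW
  obtain ⟨s, hs⟩ := main W₁ hW₁
  have : IsDirectedOrder Γ := ⟨hdir⟩
  refine mem_map.2 (mem_of_superset (mem_atTop s) fun t hst => hW₁W ?_)
  -- `r s x = r s (r t x)` is close both to `x` and to `r t x`.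
  refine ⟨r s x, hs x, hsymm.symm _ _ ?_⟩
  have := hs (r t x)
  rwa [← Function.comp_apply (f := r s), ← (hcomp s t hst).1] at this

namespace IsRSkeleton

variable {X : Type*} [TopologicalSpace X] {Γ : Type*} [PartialOrder Γ] {r : Γ → X → X}

theorem map_eq_of_mem_range (hr : IsRSkeleton r) {s t : Γ} (hst : s ≤ t) {x : X}
    (hx : x ∈ range (r s)) : r t x = x := by
  obtain ⟨y, rfl⟩ := hx
  exact (congrFun (hr.comp s t hst).2 y).symm

theorem range_mono (hr : IsRSkeleton r) {s t : Γ} (hst : s ≤ t) : range (r s) ⊆ range (r t) :=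
  fun x hx => ⟨x, hr.map_eq_of_mem_range hst hx⟩

theorem map_map_of_le (hr : IsRSkeleton r) {s t : Γ} (hst : s ≤ t) (x : X) :
    r s (r t x) = r s x :=
  (congrFun (hr.comp s t hst).1 x).symm

theorem exists_subset_range (hr : IsRSkeleton r) {C : Set X} (hC : C.Countable)
    (h : C ⊆ inducedSpace r) : ∃ s, C ⊆ range (r s) := by
  have : ∀ x, ∃ s, x ∈ C → x ∈ range (r s) := by
    intro x
    by_cases hx : x ∈ C
    · obtain ⟨s, hs⟩ := mem_iUnion.1 (h hx)
      exact ⟨s, fun _ => hs⟩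
    · exact ⟨hr.nonempty.some, fun h => absurd h hx⟩
  choose g hg using this
  obtain ⟨t, ht⟩ := exists_upper_bound_of_countable hr.nonempty hr.directed hr.sigmaComplete hC g
  exact ⟨t, fun x hx => hr.range_mono (ht x hx) (hg x hx)⟩

theorem mem_inducedSpace_of_isOpen_singleton (hr : IsRSkeleton r) {x : X}
    (hx : IsOpen ({x} : Set X)) : x ∈ inducedSpace r := by
  have := hr.nonempty
  have : IsDirectedOrder Γ := ⟨hr.directed⟩
  obtain ⟨s, hs⟩ := ((hr.tendsto_id x).eventually (hx.mem_nhds rfl)).exists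
  exact mem_iUnion.2 ⟨s, x, hs⟩

theorem isClosed_range [T2Space X] (hr : IsRSkeleton r) (s : Γ) : IsClosed (range (r s)) := by
  have : range (r s) = {x | r s x = x} := by
    ext x
    exact ⟨fun hx => hr.map_eq_of_mem_range le_rfl hx, fun hx => ⟨x, hx⟩⟩
  rw [this]
  exact isClosed_eq (hr.retraction s).1 continuous_id

/-- Serves to move the index set to another universe. -/
theorem comp_orderIso (hr : IsRSkeleton r) {Γ' : Type*} [PartialOrder Γ'] (e : Γ' ≃o Γ) :
    IsRSkeleton fun s => r (e s) := by
  have hlub : ∀ (s : ℕ → Γ') t, IsLUB (range s) t ↔ IsLUB (range fun n => e (s n)) (e t) := by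
    intro s t
    rw [← e.isLUB_image', ← range_comp]
    rfl
  refine ⟨hr.nonempty.map e.symm, fun s t => ?_, fun s hs => ?_, fun s => hr.retraction _,
    fun s => hr.cosmic _, fun s t hst => hr.comp _ _ (e.monotone hst), fun s t hs ht =>
    hr.tendsto_sup _ _ (e.monotone.comp hs) ((hlub s t).1 ht), fun x => ?_⟩
  · obtain ⟨u, hs, ht⟩ := hr.directed (e s) (e t)
    exact ⟨e.symm u, e.le_symm_apply.2 hs, e.le_symm_apply.2 ht⟩
  · obtain ⟨t, ht⟩ := hr.sigmaComplete _ (e.monotone.comp hs)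
    exact ⟨e.symm t, (hlub s _).2 (by rwa [e.apply_symm_apply])⟩
  · exact (hr.tendsto_id x).comp e.tendsto_atTop

end IsRSkeleton

/-! ### Topology of the Alexandroff duplicate -/

namespace AlexandroffDuplicate

variable {X : Type*} [TopologicalSpace X]

theorem continuous_point : Continuous (point : AlexandroffDuplicate X → X) :=
  ⟨fun U hU _ hx => ⟨U, hU, hx, fun _ hp => hp.1⟩⟩

theorem isInducing_mk_false : IsInducing fun x : X => (⟨x, false⟩ : AlexandroffDuplicate X) := by
  refine .of_comp ⟨fun S hS => ?_⟩ continuous_point IsInducing.id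
  refine isOpen_iff_forall_mem_open.2 fun x hx => ?_
  obtain ⟨U, hU, hxU, hUS⟩ := hS x hx
  exact ⟨U, fun y hy => hUS ⟨hy, by simp⟩, hU, hxU⟩

theorem continuous_mk_false : Continuous fun x : X => (⟨x, false⟩ : AlexandroffDuplicate X) :=
  isInducing_mk_false.continuous

theorem isClosed_tag_false : IsClosed {p : AlexandroffDuplicate X | p.tag = false} :=
  ⟨fun _ hx => absurd rfl hx⟩

theorem isOpen_singleton_false {x : X} (hx : IsOpen ({x} : Set X)) :
    IsOpen ({⟨x, false⟩} : Set (AlexandroffDuplicate X)) := by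
  intro y hy
  obtain rfl : y = x := congrArg point (mem_singleton_iff.1 hy)
  refine ⟨{y}, hx, rfl, ?_⟩
  rintro ⟨z, _ | _⟩ ⟨rfl : z = y, hz⟩
  · rfl
  · exact absurd rfl hz

theorem mk_false_mem_closure {B : Set X} {y : X} (hy : AccPt y (𝓟 B)) [T1Space X] :
    (⟨y, false⟩ : AlexandroffDuplicate X) ∈ closure ((fun x => ⟨x, true⟩) '' B) := by
  rw [mem_closure_iff_nhds_basis (nhds_false_hasBasis y)]
  rintro U ⟨hU, hyU⟩
  obtain ⟨b, hbU, hby, hbB⟩ := accPt_iff_frequently.1 hy |>.and_eventually (hU.mem_nhds hyU)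
    |>.exists.imp fun b hb => (⟨hb.2, hb.1⟩ : b ∈ U ∧ b ≠ y ∧ b ∈ B)
  exact ⟨⟨b, true⟩, mem_image_of_mem _ hbB, hbU, fun h => hby (congrArg point h)⟩

theorem isClosed_singleton_true [T1Space X] (x : X) :
    IsClosed ({⟨x, true⟩} : Set (AlexandroffDuplicate X)) := by
  refine ⟨fun y _ => ?_⟩
  by_cases h : y = x
  · subst h
    exact ⟨univ, isOpen_univ, mem_univ _, fun p hp => hp.2⟩
  · refine ⟨{x}ᶜ, isOpen_compl_singleton, h, ?_⟩
    rintro p hp rfl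
    exact hp.1 rfl

theorem tendsto_false_of_point [T1Space X] {ι : Type*} {l : Filter ι}
    {f : ι → AlexandroffDuplicate X} {x : X} (h : Tendsto (fun i => (f i).point) l (𝓝 x))
    (hne : ∀ᶠ i in l, f i ≠ ⟨x, true⟩) : Tendsto f l (𝓝 ⟨x, false⟩) := by
  rw [(nhds_false_hasBasis x).tendsto_right_iff]
  rintro U ⟨hU, hxU⟩
  filter_upwards [h (hU.mem_nhds hxU), hne] with i hi hi'
  exact ⟨hi, hi'⟩

instance [T2Space X] : T2Space (AlexandroffDuplicate X) := by
  refine ⟨?_⟩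
  have key : ∀ x : X, ∃ U V : Set (AlexandroffDuplicate X), IsOpen U ∧ IsOpen V ∧
      ⟨x, true⟩ ∈ U ∧ ⟨x, false⟩ ∈ V ∧ Disjoint U V := fun x =>
    ⟨{⟨x, true⟩}, {⟨x, true⟩}ᶜ, isOpen_singleton_true x,
      (isClosed_singleton_true x).isOpen_compl, rfl, by simp, disjoint_compl_right⟩
  rintro ⟨x, i⟩ ⟨y, j⟩ hxy
  by_cases h : x = y
  · subst h
    match i, j with
    | false, false => exact absurd rfl hxy
    | true, true => exact absurd rfl hxy
    | true, false => exact key x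
    | false, true =>
      obtain ⟨U, V, hU, hV, hxU, hxV, hUV⟩ := key x
      exact ⟨V, U, hV, hU, hxV, hxU, hUV.symm⟩
  · obtain ⟨U, V, hU, hV, hxU, hyV, hUV⟩ := t2_separation h
    exact ⟨_, _, hU.preimage continuous_point, hV.preimage continuous_point, hxU, hyV,
      hUV.preimage _⟩

instance [T1Space X] [CompactSpace X] : CompactSpace (AlexandroffDuplicate X) := by
  refine ⟨isCompact_iff_ultrafilter_le_nhds.2 fun F _ => ?_⟩
  obtain ⟨x, -, hx⟩ := isCompact_iff_ultrafilter_le_nhds.1 (isCompact_univ (X := X))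
    (F.map point) (by simp)
  -- Over the limit `x` of the projected ultrafilter, only concentration at `(x, 1)` can prevent
  -- convergence to `(x, 0)`.
  by_cases h : {⟨x, true⟩} ∈ F
  · refine ⟨⟨x, true⟩, mem_univ _, ?_⟩
    rw [(isOpen_singleton_iff_nhds_eq_pure _).1 (isOpen_singleton_true x)]
    exact Filter.le_pure_iff.2 h
  · exact ⟨⟨x, false⟩, mem_univ _, tendsto_false_of_point (f := id) hx
      (Ultrafilter.compl_mem_iff_notMem.2 h)⟩

end AlexandroffDuplicate

/-! ### Suprema of increasing sequences of pairs of countable sets -/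

section CountablePairs

variable {X : Type*} {Y : Set X} {Γ : Set (CountableSubsets Y × CountableSubsets Yᶜ)}

theorem exists_isLUB_countablePairs
    (s : ℕ → CountableSubsets Y × CountableSubsets Yᶜ) :
    ∃ t, IsLUB (range s) t ∧ t.1.1 = ⋃ n, (s n).1.1 ∧ t.2.1 = ⋃ n, (s n).2.1 := by
  refine ⟨⟨⟨⋃ n, (s n).1.1, iUnion_subset fun n => (s n).1.2.1,
    countable_iUnion fun n => (s n).1.2.2⟩, ⟨⋃ n, (s n).2.1, iUnion_subset fun n => (s n).2.2.1,
    countable_iUnion fun n => (s n).2.2.2⟩⟩, ⟨?_, fun b hb => ?_⟩, rfl, rfl⟩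
  · rintro _ ⟨n, rfl⟩
    exact ⟨subset_iUnion (fun n => (s n).1.1) n, subset_iUnion (fun n => (s n).2.1) n⟩
  · exact ⟨iUnion_subset fun n => (hb ⟨n, rfl⟩).1, iUnion_subset fun n => (hb ⟨n, rfl⟩).2⟩

theorem IsSigmaClosed.exists_isLUB (hΓ : IsSigmaClosed Γ) {s : ℕ → Γ} (hs : Monotone s) :
    ∃ t : Γ, IsLUB (range s) t ∧ t.1.1.1 = ⋃ n, (s n).1.1.1 ∧
      t.1.2.1 = ⋃ n, (s n).1.2.1 := by
  obtain ⟨t, ht, h₁, h₂⟩ := exists_isLUB_countablePairs fun n => (s n).1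
  refine ⟨⟨t, hΓ _ t (fun m n h => hs h) (fun n => (s n).2) ht⟩, ⟨?_, fun b hb => ht.2 ?_⟩,
    h₁, h₂⟩
  · rintro _ ⟨n, rfl⟩
    exact ht.1 ⟨n, rfl⟩
  · rintro _ ⟨n, rfl⟩
    exact hb ⟨n, rfl⟩

theorem IsSigmaClosed.eq_iUnion_of_isLUB (hΓ : IsSigmaClosed Γ) {s : ℕ → Γ} (hs : Monotone s)
    {t : Γ} (ht : IsLUB (range s) t) :
    t.1.1.1 = ⋃ n, (s n).1.1.1 ∧ t.1.2.1 = ⋃ n, (s n).1.2.1 := by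
  obtain ⟨t', ht', h⟩ := hΓ.exists_isLUB hs
  rwa [ht.unique ht']

/-- The union of the two members of a pair. -/
def pairUnion (p : CountableSubsets Y × CountableSubsets Yᶜ) : Set X := p.1.1 ∪ p.2.1

theorem countable_pairUnion (p : CountableSubsets Y × CountableSubsets Yᶜ) :
    (pairUnion p).Countable :=
  p.1.2.2.union p.2.2.2

theorem pairUnion_mono : Monotone (pairUnion (Y := Y)) :=
  fun _ _ h => union_subset_union h.1 h.2

theorem IsSigmaClosed.pairUnion_eq_iUnion (hΓ : IsSigmaClosed Γ) {s : ℕ → Γ} (hs : Monotone s)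
    {t : Γ} (ht : IsLUB (range s) t) : pairUnion t.1 = ⋃ n, pairUnion (s n).1 := by
  obtain ⟨h₁, h₂⟩ := hΓ.eq_iUnion_of_isLUB hs ht
  simp only [pairUnion, h₁, h₂, iUnion_union_distrib]

theorem IsCofinal.exists_mem_pairUnion (hΓ : IsCofinal Γ) (x : X) :
    ∃ s : Γ, x ∈ pairUnion s.1 := by
  have : ∃ p : CountableSubsets Y × CountableSubsets Yᶜ, x ∈ pairUnion p := by
    by_cases hx : x ∈ Y
    · exact ⟨⟨⟨{x}, by simpa, countable_singleton x⟩, ⟨∅, empty_subset _, countable_empty⟩⟩,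
        Or.inl rfl⟩
    · exact ⟨⟨⟨∅, empty_subset _, countable_empty⟩, ⟨{x}, by simpa, countable_singleton x⟩⟩,
        Or.inr rfl⟩
  obtain ⟨p, hp⟩ := this
  obtain ⟨q, hq, hpq⟩ := hΓ p
  exact ⟨⟨q, hq⟩, pairUnion_mono hpq hp⟩

end CountablePairs

/-! ### From the space to its Alexandroff duplicate -/

namespace AlexandroffDuplicate

variable {X : Type*}

open Classical in
/-- The extension of a self-map `r` of `X` to the Alexandroff duplicate which fixes the isolated
points over `C`. -/
noncomputable def extend (r : X → X) (C : Set X) (p : AlexandroffDuplicate X) :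
    AlexandroffDuplicate X :=
  if p.tag = true ∧ p.point ∈ C then p else ⟨r p.point, false⟩

variable {r : X → X} {C : Set X}

theorem extend_of_mem {x : X} (hx : x ∈ C) : extend r C ⟨x, true⟩ = ⟨x, true⟩ :=
  if_pos ⟨rfl, hx⟩

theorem extend_of_notMem {p : AlexandroffDuplicate X} (hp : ¬(p.tag = true ∧ p.point ∈ C)) :
    extend r C p = ⟨r p.point, false⟩ :=
  if_neg hp

theorem extend_false (x : X) : extend r C ⟨x, false⟩ = ⟨r x, false⟩ :=
  if_neg (by simp)

theorem extend_extend_of_left_subset {r' : X → X} {C' : Set X} (hC : C ⊆ C')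
    (h : ∀ x, r (r' x) = r x) (p : AlexandroffDuplicate X) :
    extend r C (extend r' C' p) = extend r C p := by
  by_cases hp : p.tag = true ∧ p.point ∈ C'
  · rw [show extend r' C' p = p from if_pos hp]
  · rw [extend_of_notMem hp, extend_false, h, extend_of_notMem fun h' => hp ⟨h'.1, hC h'.2⟩]

theorem extend_extend_of_right_subset {r' : X → X} {C' : Set X} (hC : C ⊆ C')
    (h : ∀ x, r' (r x) = r x) (p : AlexandroffDuplicate X) :
    extend r' C' (extend r C p) = extend r C p := by
  by_cases hp : p.tag = true ∧ p.point ∈ C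
  · rw [show extend r C p = p from if_pos hp]
    exact if_pos ⟨hp.1, hC hp.2⟩
  · rw [extend_of_notMem hp, extend_false, h]

variable [TopologicalSpace X]

theorem continuous_extend [T1Space X] (hr : Continuous r) {A B : Set X}
    (hA : ∀ x ∈ A, r x = x) (hB : IsDiscrete B) (hcl : ∀ x ∈ closure B \ B, r x = x) :
    Continuous (extend r (A ∪ B)) := by
  rw [continuous_iff_continuousAt]
  rintro ⟨x, _ | _⟩
  · have hx : Tendsto point (𝓝 (⟨x, false⟩ : AlexandroffDuplicate X)) (𝓝 x) :=
      continuous_point.tendsto _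
    have hne : ∀ᶠ p in 𝓝 (⟨x, false⟩ : AlexandroffDuplicate X), p ≠ ⟨x, true⟩ :=
      (isClosed_singleton_true x).isOpen_compl.mem_nhds (by simp)
    have hrp : Tendsto (fun p => r p.point) (𝓝 (⟨x, false⟩ : AlexandroffDuplicate X))
        (𝓝 (r x)) := (hr.tendsto x).comp hx
    rw [ContinuousAt, extend_false]
    -- If `r x = x`, both branches of `extend` have points tending to `x`. Otherwise the branches
    -- must agree up to the tag near `x`, which is where the conditions on `A` and `B` enter.
    by_cases hrx : r x = x
    · refine tendsto_false_of_point (fun U hU => ?_) ?_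
      · rw [hrx] at hU
        rw [mem_map]
        filter_upwards [(hrx ▸ hrp) hU, hx hU] with p h₁ h₂
        by_cases hp : p.tag = true ∧ p.point ∈ A ∪ B
        · rwa [mem_preimage, show extend r (A ∪ B) p = p from if_pos hp]
        · rwa [mem_preimage, extend_of_notMem hp]
      · filter_upwards [hne] with p h
        by_cases hp : p.tag = true ∧ p.point ∈ A ∪ B
        · rwa [show extend r (A ∪ B) p = p from if_pos hp, hrx]
        · simp [extend_of_notMem hp]
    · have hiso : ∀ᶠ y in 𝓝 x, y ≠ x → y ∉ B := by
        by_cases hxB : x ∈ B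
        · have h := discreteTopology_subtype_iff.1 hB.to_subtype x hxB
          exact eventually_nhdsWithin_iff.1 (inf_principal_eq_bot.1 h)
        · have : x ∉ closure B := fun h => hrx (hcl x ⟨h, hxB⟩)
          filter_upwards [isClosed_closure.isOpen_compl.mem_nhds this] with y hy _ hyB
          exact hy (subset_closure hyB)
      have hfix : ∀ᶠ p in 𝓝 (⟨x, false⟩ : AlexandroffDuplicate X),
          p.tag = true ∧ p.point ∈ A ∪ B → r p.point = p.point := by
        filter_upwards [hne, hx.eventually hiso]
        rintro ⟨y, i⟩ hy hyB ⟨rfl : i = true, hyA | hyB'⟩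
        · exact hA y hyA
        · exact absurd hyB' (hyB (by rintro rfl; exact hy rfl))
      refine tendsto_false_of_point (hrp.congr' ?_) ?_
      · filter_upwards [hfix] with p h
        by_cases hp : p.tag = true ∧ p.point ∈ A ∪ B
        · rw [show extend r (A ∪ B) p = p from if_pos hp, h hp]
        · rw [extend_of_notMem hp]
      · filter_upwards [hx.eventually_ne (Ne.symm hrx)] with p h
        by_cases hp : p.tag = true ∧ p.point ∈ A ∪ B
        · rw [show extend r (A ∪ B) p = p from if_pos hp]
          exact fun h' => h (congrArg point h')
        · simp [extend_of_notMem hp]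
  · rw [ContinuousAt, (isOpen_singleton_iff_nhds_eq_pure _).1 (isOpen_singleton_true x)]
    exact (tendsto_pure_nhds _ _)

theorem isRSkeleton_extend [T2Space X] {Y : Set X}
    {Γ : Set (CountableSubsets Y × CountableSubsets Yᶜ)} {r : Γ → X → X} (hr : IsRSkeleton r)
    (hΓ : IsSigmaClosed Γ) (hcof : IsCofinal Γ)
    (hB : ∀ B : Set X, B ⊆ Yᶜ → B.Countable → IsDiscrete B)
    (h : ∀ s : Γ, s.1.1.1 ⊆ range (r s) ∧ closure s.1.2.1 \ s.1.2.1 ⊆ range (r s)) :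
    IsRSkeleton fun s : Γ => extend (r s) (pairUnion s.1) where
  nonempty := hr.nonempty
  directed := hr.directed
  sigmaComplete := hr.sigmaComplete
  retraction s := by
    refine ⟨continuous_extend (hr.retraction s).1
      (fun x hx => hr.map_eq_of_mem_range le_rfl ((h s).1 hx)) (hB _ s.1.2.2.1 s.1.2.2.2)
      fun x hx => hr.map_eq_of_mem_range le_rfl ((h s).2 hx),
      extend_extend_of_left_subset Subset.rfl (hr.retraction s).2⟩
  cosmic s := by
    refine (hr.cosmic s).of_subset_image_union continuous_mk_false
      ((countable_pairUnion s.1).image fun x => (⟨x, true⟩ : AlexandroffDuplicate X)) ?_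
    rintro _ ⟨p, rfl⟩
    by_cases hp : p.tag = true ∧ p.point ∈ pairUnion s.1
    · obtain ⟨x, i⟩ := p
      obtain ⟨rfl : i = true, hx⟩ := hp
      exact Or.inr ⟨x, hx, (extend_of_mem hx).symm⟩
    · exact Or.inl ⟨_, ⟨p.point, rfl⟩, (extend_of_notMem hp).symm⟩
  comp s t hst := by
    have hC := pairUnion_mono (Y := Y) hst
    exact ⟨funext fun p => (extend_extend_of_left_subset hC (hr.map_map_of_le hst) p).symm,
      funext fun p => (extend_extend_of_right_subset hC
        (fun x => hr.map_eq_of_mem_range hst ⟨x, rfl⟩) p).symm⟩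
  tendsto_sup s t hs ht p := by
    have hC := hΓ.pairUnion_eq_iUnion hs ht
    by_cases hp : p.tag = true ∧ p.point ∈ pairUnion t.1
    · obtain ⟨n, hn⟩ := mem_iUnion.1 (hC ▸ hp.2)
      rw [show extend (r t) (pairUnion t.1) p = p from if_pos hp]
      refine tendsto_const_nhds.congr' ?_
      filter_upwards [eventually_ge_atTop n] with m hm
      exact (if_pos ⟨hp.1, pairUnion_mono (Y := Y) (hs hm) hn⟩).symm
    · have hp' : ∀ n, ¬(p.tag = true ∧ p.point ∈ pairUnion (s n).1) := fun n hn =>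
        hp ⟨hn.1, hC ▸ mem_iUnion.2 ⟨n, hn.2⟩⟩
      simp only [extend_of_notMem hp, extend_of_notMem (hp' _)]
      exact (continuous_mk_false.tendsto _).comp (hr.tendsto_sup s t hs ht p.point)
  tendsto_id := by
    rintro ⟨x, _ | _⟩
    · simp only [extend_false]
      exact (continuous_mk_false.tendsto _).comp (hr.tendsto_id x)
    · obtain ⟨s, hs⟩ := hcof.exists_mem_pairUnion x
      refine tendsto_const_nhds.congr' ?_
      have := hr.nonempty
      have : IsDirectedOrder Γ := ⟨hr.directed⟩
      filter_upwards [eventually_ge_atTop s] with t hst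
      exact (extend_of_mem (pairUnion_mono (Y := Y) hst hs)).symm

end AlexandroffDuplicate

/-! ### From the Alexandroff duplicate to the space -/

namespace AlexandroffDuplicate

variable {X : Type*}

/-- The self-map of `X` obtained from a self-map of the Alexandroff duplicate by restricting it to
`X × {0}`. -/
def restrict (f : AlexandroffDuplicate X → AlexandroffDuplicate X) (x : X) : X :=
  (f ⟨x, false⟩).point

theorem mk_restrict {f : AlexandroffDuplicate X → AlexandroffDuplicate X}
    (hf : ∀ x, (f ⟨x, false⟩).tag = false) (x : X) : ⟨restrict f x, false⟩ = f ⟨x, false⟩ :=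
  AlexandroffDuplicate.ext rfl (hf x).symm

variable [TopologicalSpace X] {Γ : Type*} [PartialOrder Γ]
  {R : Γ → AlexandroffDuplicate X → AlexandroffDuplicate X}

theorem mk_true_mem_inducedSpace (hR : IsRSkeleton R) (x : X) :
    ⟨x, true⟩ ∈ inducedSpace R :=
  hR.mem_inducedSpace_of_isOpen_singleton (isOpen_singleton_true x)

theorem mk_false_mem_range [T2Space X] (hR : IsRSkeleton R) {s : Γ} {B : Set X}
    (hB : ∀ b ∈ B, ⟨b, true⟩ ∈ range (R s)) {y : X} (hy : AccPt y (𝓟 B)) :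
    ⟨y, false⟩ ∈ range (R s) :=
  closure_minimal (by rintro _ ⟨b, hb, rfl⟩; exact hB b hb) (hR.isClosed_range s)
    (mk_false_mem_closure hy)

theorem mk_false_mem_inducedSpace [T2Space X] (hR : IsRSkeleton R) {B : Set X}
    (hB : B.Countable) {y : X} (hy : AccPt y (𝓟 B)) : ⟨y, false⟩ ∈ inducedSpace R := by
  obtain ⟨s, hs⟩ := hR.exists_subset_range (hB.image fun b => (⟨b, true⟩ : AlexandroffDuplicate X))
    (by rintro _ ⟨b, -, rfl⟩; exact mk_true_mem_inducedSpace hR b)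
  exact mem_iUnion.2 ⟨s, mk_false_mem_range hR (fun b hb => hs ⟨b, hb, rfl⟩) hy⟩

theorem accPt_of_mem_closure_diff {B : Set X} {y : X} (hy : y ∈ closure B \ B) :
    AccPt y (𝓟 B) := by
  refine accPt_iff_frequently.2 ((mem_closure_iff_frequently.1 hy.1).mono fun b hb => ⟨?_, hb⟩)
  rintro rfl
  exact hy.2 hb

/-- Over an isolated `x` the point `(x, 0)` is isolated too. A closed neighbourhood of a
non-isolated point is infinite, so it contains an accumulation point of one of its countable
subsets. -/
theorem dense_setOf_mk_false_mem_inducedSpace [T2Space X] [CompactSpace X]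
    (hR : IsRSkeleton R) : Dense {x : X | ⟨x, false⟩ ∈ inducedSpace R} := by
  rw [dense_iff_inter_open]
  rintro U hU ⟨x, hx⟩
  by_cases hxo : IsOpen ({x} : Set X)
  · exact ⟨x, hx, hR.mem_inducedSpace_of_isOpen_singleton (isOpen_singleton_false hxo)⟩
  · obtain ⟨V, hV, hVc, hVU⟩ := exists_mem_nhds_isClosed_subset (hU.mem_nhds hx)
    have : (𝓝[≠] x).NeBot := ⟨fun h => hxo (isOpen_singleton_iff_punctured_nhds x |>.2 h)⟩
    have hVinf : V.Infinite := infinite_of_mem_nhds x hV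
    obtain ⟨B, hBV, hBinf, hB⟩ : ∃ B ⊆ V, B.Infinite ∧ B.Countable := by
      refine ⟨range fun n => (hVinf.natEmbedding V n : X), ?_, ?_, countable_range _⟩
      · rintro _ ⟨n, rfl⟩
        exact (hVinf.natEmbedding V n).2
      · exact infinite_range_of_injective
          (Subtype.val_injective.comp (hVinf.natEmbedding V).injective)
    obtain ⟨y, hyV, hy⟩ := hBinf.exists_accPt_of_subset_isCompact hVc.isCompact hBV
    exact ⟨y, hVU hyV, mk_false_mem_inducedSpace hR hB hy⟩

/-- The indices of the maps which preserve `X × {0}`. -/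
def preservingIndices (R : Γ → AlexandroffDuplicate X → AlexandroffDuplicate X) : Set Γ :=
  {s | ∀ x, (R s ⟨x, false⟩).tag = false}

theorem isSigmaClosed_preservingIndices (hR : IsRSkeleton R) :
    IsSigmaClosed (preservingIndices R) := fun s t hs hsG ht x =>
  isClosed_tag_false.mem_of_tendsto (hR.tendsto_sup s t hs ht ⟨x, false⟩)
    (.of_forall fun n => hsG n x)

/-- The successor step for cofinality. Only countably many isolated points lie in the cosmic range
of `R s`. The fibre of each over `X × {0}` is open, so if non-empty it contains, by density, a point
of the induced space; one larger `t` fixes all the chosen points. -/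
theorem exists_le_fixing [T2Space X] [CompactSpace X] (hR : IsRSkeleton R) (s : Γ) :
    ∃ t, s ≤ t ∧ ∀ x y, R s ⟨x, false⟩ = ⟨y, true⟩ →
      ∃ e, R s ⟨e, false⟩ = ⟨y, true⟩ ∧ R t ⟨e, false⟩ = ⟨e, false⟩ := by
  let C : Set X := {y | ∃ x, R s ⟨x, false⟩ = ⟨y, true⟩}
  have hC : C.Countable := by
    refine ((hR.cosmic s).countable_isolated.preimage (f := fun y => ⟨y, true⟩)
      fun y y' h => congrArg point h).mono ?_
    rintro y ⟨x, hx⟩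
    exact ⟨⟨_, hx⟩, isOpen_singleton_true y⟩
  have key : ∀ y, ∃ e, y ∈ C → R s ⟨e, false⟩ = ⟨y, true⟩ ∧ ⟨e, false⟩ ∈ inducedSpace R := by
    intro y
    by_cases hy : y ∈ C
    · have hU : IsOpen {x | R s ⟨x, false⟩ = ⟨y, true⟩} :=
        (isOpen_singleton_true y).preimage ((hR.retraction s).1.comp continuous_mk_false)
      obtain ⟨e, he, heD⟩ := (dense_setOf_mk_false_mem_inducedSpace hR).inter_open_nonempty _ hU hy
      exact ⟨e, fun _ => ⟨he, heD⟩⟩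
    · exact ⟨y, fun h => absurd h hy⟩
  choose e he using key
  obtain ⟨a, ha⟩ := hR.exists_subset_range
    (hC.image fun y => (⟨e y, false⟩ : AlexandroffDuplicate X))
    (by rintro _ ⟨y, hy, rfl⟩; exact (he y hy).2)
  obtain ⟨t, hst, hat⟩ := hR.directed s a
  exact ⟨t, hst, fun x y hxy => ⟨e y, (he y ⟨x, hxy⟩).1,
    hR.map_eq_of_mem_range hat (ha ⟨y, ⟨x, hxy⟩, rfl⟩)⟩⟩

theorem isCofinal_preservingIndices [T2Space X] [CompactSpace X] (hR : IsRSkeleton R) :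
    IsCofinal (preservingIndices R) := by
  intro s₀
  choose next hle hnext using exists_le_fixing hR
  let s : ℕ → Γ := fun n => next^[n] s₀
  have hsucc : ∀ n, s (n + 1) = next (s n) := fun n => Function.iterate_succ_apply' _ _ _
  have hs : Monotone s := monotone_nat_of_le_succ fun n => hsucc n ▸ hle (s n)
  obtain ⟨t, ht⟩ := hR.sigmaComplete s hs
  have hst : ∀ n, s n ≤ t := fun n => ht.1 ⟨n, rfl⟩
  refine ⟨t, fun x => ?_, hst 0⟩
  by_contra hx
  obtain ⟨y, hy⟩ : ∃ y, R t ⟨x, false⟩ = ⟨y, true⟩ :=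
    ⟨(R t ⟨x, false⟩).point, AlexandroffDuplicate.ext rfl (by simpa using hx)⟩
  have hyt : R t ⟨y, true⟩ = ⟨y, true⟩ := hR.map_eq_of_mem_range le_rfl ⟨_, hy⟩
  have hfix : ∀ᶠ n in atTop, R (s n) ⟨y, true⟩ = ⟨y, true⟩ := by
    have := hR.tendsto_sup s t hs ht ⟨y, true⟩
    rw [hyt] at this
    exact this.eventually ((isOpen_singleton_true y).mem_nhds rfl)
  -- This `V` is an open neighbourhood of the diagonal since `(y, 1)` is isolated and closed. Hence
  -- for large `n`, `R (s n)` identifies `(y, 1)` with no other point of the range of `R t`; the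
  -- point `(e, 0)` below contradicts this.
  obtain ⟨N, hN⟩ := exists_forall_map_eq_imp_mem (fun n => (hR.retraction (s n)).1)
    (fun m n h p => hR.map_map_of_le (hs h) p) (isCompact_range (hR.retraction t).1)
    (fun p hp => by simpa only [hR.map_eq_of_mem_range le_rfl hp] using hR.tendsto_sup s t hs ht p)
    (V := {p | p.1 = ⟨y, true⟩ ∨ p.2 ≠ ⟨y, true⟩})
    (((isOpen_singleton_true y).preimage continuous_fst).union
      ((isClosed_singleton_true y).isOpen_compl.preimage continuous_snd)) (fun p => em _)
  obtain ⟨n, hn, hNn⟩ := (hfix.and (eventually_ge_atTop N)).exists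
  have hxn : R (s n) ⟨x, false⟩ = ⟨y, true⟩ := by
    rw [← hR.map_map_of_le (hst n), hy, hn]
  obtain ⟨e, he, hen⟩ := hnext (s n) x y hxn
  have het : R t ⟨e, false⟩ = ⟨e, false⟩ :=
    hR.map_eq_of_mem_range (hsucc n ▸ hst (n + 1)) ⟨_, hen⟩
  rcases hN n hNn ⟨e, false⟩ ⟨_, het⟩ ⟨y, true⟩ ⟨_, hyt⟩ (he.trans hn.symm) with h | h
  · exact Bool.false_ne_true (congrArg tag h)
  · exact h rfl

theorem mem_range_restrict (hR : IsRSkeleton R) {s : Γ} (hs : s ∈ preservingIndices R) {x : X} :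
    x ∈ range (restrict (R s)) ↔ ⟨x, false⟩ ∈ range (R s) := by
  refine ⟨?_, fun hx => ⟨x, congrArg point (hR.map_eq_of_mem_range le_rfl hx)⟩⟩
  rintro ⟨y, rfl⟩
  exact ⟨_, (mk_restrict hs y).symm⟩

theorem isCosmicSpace_of_mk_false_mem_range (hR : IsRSkeleton R) (s : Γ) {A : Set X}
    (hA : ∀ x ∈ A, ⟨x, false⟩ ∈ range (R s)) : IsCosmicSpace A := by
  refine (hR.cosmic s).of_isInducing (f := fun x : A => ⟨⟨x, false⟩, hA x x.2⟩) ?_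
  refine .of_comp ?_ continuous_subtype_val (isInducing_mk_false.comp .subtypeVal)
  exact (continuous_mk_false.comp continuous_subtype_val).subtype_mk _

theorem exists_isRSkeleton_of_isRSkeleton [T2Space X] [CompactSpace X] (hR : IsRSkeleton R) :
    ∃ (Y : Set X) (Γ : Set (CountableSubsets Y × CountableSubsets Yᶜ)) (r : Γ → X → X),
      IsRSkeleton r ∧ inducedSpace r = Y ∧ IsSigmaClosed Γ ∧ IsCofinal Γ ∧
      (∀ B : Set X, B ⊆ Yᶜ → B.Countable →
        IsDiscrete B ∧ closure B \ B ⊆ Y ∧ IsCosmicSpace ↥(closure B \ B)) ∧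
      (∀ s : Γ, s.1.1.1 ⊆ range (r s) ∧ closure s.1.2.1 \ s.1.2.1 ⊆ range (r s)) := by
  -- `g x` captures `(x, 1)`, needed for the closure half of (***), and `(x, 0)` when `x ∈ Y`,
  -- needed for `A`.
  have hg : ∀ x : X, ∃ s, ⟨x, true⟩ ∈ range (R s) ∧
      (⟨x, false⟩ ∈ inducedSpace R → ⟨x, false⟩ ∈ range (R s)) := by
    intro x
    obtain ⟨s, hs⟩ := hR.exists_subset_range
      (C := {p | p.point = x ∧ p ∈ inducedSpace R})
      (((toFinite {(⟨x, true⟩ : AlexandroffDuplicate X), ⟨x, false⟩}).subset (by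
        rintro ⟨y, _ | _⟩ ⟨rfl : y = x, -⟩ <;> simp)).countable) fun p hp => hp.2
    exact ⟨s, hs ⟨rfl, mk_true_mem_inducedSpace hR x⟩, fun h => hs ⟨rfl, h⟩⟩
  choose g hgt hgf using hg
  obtain ⟨ψ, hψG, hψg, hψm, hψσ⟩ := exists_monotone_countable_map hR.nonempty hR.directed
    hR.sigmaComplete (isCofinal_preservingIndices hR) (isSigmaClosed_preservingIndices hR) g
  let Y : Set X := {x | ⟨x, false⟩ ∈ inducedSpace R}
  let Δ : Set (CountableSubsets Y × CountableSubsets Yᶜ) := univ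
  have hΔ : IsSigmaClosed Δ := fun _ _ _ _ _ => mem_univ _
  have hΔc : IsCofinal Δ := fun p => ⟨p, mem_univ _, le_rfl⟩
  let i : Δ → Γ := fun s => ψ (pairUnion s.1)
  have hi : Monotone i := fun s t hst =>
    hψm _ _ (countable_pairUnion _) (countable_pairUnion _) (pairUnion_mono (Y := Y) hst)
  have hiG : ∀ s, i s ∈ preservingIndices R := fun s => hψG _ (countable_pairUnion _)
  have higt : ∀ s : Δ, ∀ x ∈ pairUnion s.1, ⟨x, true⟩ ∈ range (R (i s)) := fun s x hx =>
    hR.range_mono (hψg _ (countable_pairUnion _) x hx) (hgt x)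
  have higf : ∀ s : Δ, ∀ x ∈ pairUnion s.1, x ∈ Y → ⟨x, false⟩ ∈ range (R (i s)) :=
    fun s x hx hxY => hR.range_mono (hψg _ (countable_pairUnion _) x hx) (hgf x hxY)
  have hlub : ∀ (s : ℕ → Δ) (t : Δ), Monotone s → IsLUB (range s) t →
      IsLUB (range fun n => i (s n)) (i t) := by
    intro s t hs ht
    have := hψσ (fun n => pairUnion (s n).1) (fun m n h => pairUnion_mono (Y := Y) (hs h))
      fun n => countable_pairUnion _
    rwa [← hΔ.pairUnion_eq_iUnion hs ht] at this
  let r : Δ → X → X := fun s => restrict (R (i s))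
  have hrange : ∀ s x, x ∈ range (r s) ↔ ⟨x, false⟩ ∈ range (R (i s)) := fun s x =>
    mem_range_restrict hR (hiG s)
  have hY : inducedSpace r = Y := by
    ext x
    refine ⟨fun hx => ?_, fun hx => ?_⟩
    · obtain ⟨s, hs⟩ := mem_iUnion.1 hx
      exact mem_iUnion.2 ⟨_, (hrange s x).1 hs⟩
    · obtain ⟨s, hs⟩ := hΔc.exists_mem_pairUnion x
      exact mem_iUnion.2 ⟨s, (hrange s x).2 (higf s x hs hx)⟩
  have hne : Nonempty Δ :=
    ⟨⟨⟨⟨∅, empty_subset _, countable_empty⟩, ⟨∅, empty_subset _, countable_empty⟩⟩, mem_univ _⟩⟩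
  have hdir : ∀ s t : Δ, ∃ u, s ≤ u ∧ t ≤ u := fun s t =>
    ⟨⟨⟨⟨s.1.1.1 ∪ t.1.1.1, union_subset s.1.1.2.1 t.1.1.2.1, s.1.1.2.2.union t.1.1.2.2⟩,
      ⟨s.1.2.1 ∪ t.1.2.1, union_subset s.1.2.2.1 t.1.2.2.1, s.1.2.2.2.union t.1.2.2.2⟩⟩,
      mem_univ _⟩, ⟨subset_union_left, subset_union_left⟩, ⟨subset_union_right, subset_union_right⟩⟩
  have hsup : ∀ s : ℕ → Δ, Monotone s → ∃ t, IsLUB (range s) t := fun s hs =>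
    (hΔ.exists_isLUB hs).imp fun _ h => h.1
  have hcomp : ∀ s t, s ≤ t → r s = r s ∘ r t ∧ r s = r t ∘ r s := by
    intro s t hst
    refine ⟨funext fun x => ?_, funext fun x => ?_⟩
    · simp only [r, Function.comp_apply]
      conv_rhs => rw [restrict, mk_restrict (hiG t), hR.map_map_of_le (hi hst)]
      rfl
    · simp only [r, Function.comp_apply]
      conv_rhs => rw [restrict, mk_restrict (hiG s), hR.map_eq_of_mem_range (hi hst) ⟨_, rfl⟩]
      rfl
  have hret : ∀ s, IsRetraction (r s) := fun s =>
    ⟨continuous_point.comp ((hR.retraction (i s)).1.comp continuous_mk_false),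
      fun x => (congrFun (hcomp s s le_rfl).1 x).symm⟩
  have hlim : ∀ (s : ℕ → Δ) (t : Δ), Monotone s → IsLUB (range s) t →
      ∀ x, Tendsto (fun n => r (s n) x) atTop (𝓝 (r t x)) := fun s t hs ht x =>
    (continuous_point.tendsto _).comp
      (hR.tendsto_sup (fun n => i (s n)) (i t) (hi.comp hs) (hlub s t hs ht) ⟨x, false⟩)
  have hdense : Dense (inducedSpace r) := hY.symm ▸ dense_setOf_mk_false_mem_inducedSpace hR
  refine ⟨Y, Δ, r, ⟨hne, hdir, hsup, hret, fun s => ?_, hcomp, hlim,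
    tendsto_id_of_dense_inducedSpace hne hdir hsup hret hcomp hlim hdense⟩, hY, hΔ, hΔc,
    fun B hBY hB => ?_, fun s => ⟨fun x hx => ?_, fun x hx => ?_⟩⟩
  · exact isCosmicSpace_of_mk_false_mem_range hR (i s) fun x hx => (hrange s x).1 hx
  · refine ⟨⟨discreteTopology_subtype_iff.2 fun x hx => ?_⟩, fun x hx => ?_, ?_⟩
    -- A point of `B` at which `B` accumulates would belong to `Y`.
    · by_contra h
      exact hBY hx (mk_false_mem_inducedSpace hR hB ⟨h⟩)
    · exact mk_false_mem_inducedSpace hR hB (accPt_of_mem_closure_diff hx)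
    · obtain ⟨s, hs⟩ := hR.exists_subset_range
        (hB.image fun b => (⟨b, true⟩ : AlexandroffDuplicate X))
        (by rintro _ ⟨b, -, rfl⟩; exact mk_true_mem_inducedSpace hR b)
      exact isCosmicSpace_of_mk_false_mem_range hR s fun x hx =>
        mk_false_mem_range hR (fun b hb => hs ⟨b, hb, rfl⟩) (accPt_of_mem_closure_diff hx)
  · exact (hrange s x).2 (higf s x (Or.inl hx) (s.1.1.2.1 hx))
  · exact (hrange s x).2 (mk_false_mem_range hR (fun b hb => higt s b (Or.inr hb))
      (accPt_of_mem_closure_diff hx))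

end AlexandroffDuplicate

theorem mainTheorem1 (X : Type u) [TopologicalSpace X] [CompactSpace X] [T2Space X] :
    AdmitsRSkeleton.{max u v} (AlexandroffDuplicate X) ↔
      ∃ (Y : Set X) (Γ : Set (CountableSubsets Y × CountableSubsets Yᶜ)) (r : Γ → X → X),
        IsRSkeleton r ∧ inducedSpace r = Y ∧
        IsSigmaClosed Γ ∧ IsCofinal Γ ∧
        (∀ B : Set X, B ⊆ Yᶜ → B.Countable →
          IsDiscrete B ∧ closure B \ B ⊆ Y ∧ IsCosmicSpace ↥(closure B \ B)) ∧
        (∀ s : Γ, s.1.1.1 ⊆ range (r s) ∧ closure s.1.2.1 \ s.1.2.1 ⊆ range (r s)) := by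
  constructor
  · rintro ⟨Γ, _, R, hR⟩
    exact AlexandroffDuplicate.exists_isRSkeleton_of_isRSkeleton hR
  · rintro ⟨Y, Γ, r, hr, -, hΓ, hcof, hB, h⟩
    exact ⟨ULift.{max u v} Γ, inferInstance, _,
      (AlexandroffDuplicate.isRSkeleton_extend hr hΓ hcof (fun B hBY hBc => (hB B hBY hBc).1)
        h).comp_orderIso ULift.orderIso⟩
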